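/- Let $N\ge 1$ and let $\Omega\subset\mathbb{R}^N$ be a domain (a nonempty, connected, open set, not necessarily bounded or regular) with finite Lebesgue measure, $|\Omega|<\infty$. Let $H^1(\Omega)$ be the space of real-valued $f\in \mathrm{L}^2(\Omega)$ whose weak gradient $\nabla f$ belongs to $[\mathrm{L}^2(\Omega)]^N$, with norm $(\|f\|_2^2+\|\nabla f\|_2^2)^{1/2}$, where $\|\cdot\|_p$ is the norm (quasi-norm if $p<1$) of $\mathrm{L}^p(\Omega)$. Suppose that $\Omega$ supports the Gagliardo–Nirenberg–Sobolev inequalities $$\|f\|_r\le C_S\,\big(\|\nabla f\|_2+\|f\|_2\big)^{\vartheta(s,r,N)}\,\|f\|_s^{1-\vartheta(s,r,N)}\qquad\forall f\in H^1(\Omega)\cap \mathrm{L}^s(\Omega),\qquad \vartheta(s,r,N):=\frac{2N(r-s)}{r\,[2N-s(N-2)]},$$ for all $r,s$ such that $0<s<r<\infty$ if $N\in\{1,2\}$, and for all $r,s$ such that $0<s<r\le 2^\star$ or $2^\star\le r<s<\infty$, with $2^\star:=\frac{2N}{N-2}$, if $N\ge 3$; here $C_S=C_S(s,r)>0$ does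 not depend on $f$ and is bounded as long as $r,s$ range in compact subsets of $(0,\infty)$. Then the embedding $H^1(\Omega)\hookrightarrow \mathrm{L}^2(\Omega)$ is compact, and the Poincaré inequality holds on $\Omega$: there is a constant $C_P>0$ such that $$\|f-\overline f\|_2\le C_P\,\|\nabla f\|_2\qquad\forall f\in H^1(\Omega),\qquad \overline f:=\frac{1}{|\Omega|}\int_\Omega f(x)\,dx .$$ -/

import Mathlib

open MeasureTheory
open scoped ContDiff ENNReal

noncomputable section

/-- `ℝ^N` with its Euclidean norm. -/
abbrev RN (N : ℕ) : Type := EuclideanSpace ℝ (Fin N)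

/-- A domain of `ℝ^N`: a nonempty connected open set. -/
def IsDomainOfRN {N : ℕ} (Ω : Set (RN N)) : Prop :=
  IsOpen Ω ∧ IsConnected Ω

/-- Test functions on `Ω`: smooth functions whose support is compact and contained in `Ω`. -/
def IsTestFun {N : ℕ} (Ω : Set (RN N)) (φ : RN N → ℝ) : Prop :=
  ContDiff ℝ ∞ φ ∧ HasCompactSupport φ ∧ tsupport φ ⊆ Ω

/-- The classical partial derivative `∂φ/∂x_i`. -/
def partialDeriv {N : ℕ} (i : Fin N) (φ : RN N → ℝ) (x : RN N) : ℝ :=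
  fderiv ℝ φ x (EuclideanSpace.single i 1)

/-- `g` is the weak gradient of `f` in `Ω`:
`∫_Ω f ∂_i φ = - ∫_Ω g_i φ` for all test functions `φ` and all `i`. -/
def IsWeakGradient {N : ℕ} (Ω : Set (RN N)) (f : RN N → ℝ) (g : RN N → RN N) : Prop :=
  ∀ φ : RN N → ℝ, IsTestFun Ω φ → ∀ i : Fin N,
    ∫ x in Ω, f x * partialDeriv i φ x = - ∫ x in Ω, g x i * φ x

/-- `L²(Ω)`. -/
abbrev L2 {N : ℕ} (Ω : Set (RN N)) : Type :=
  Lp ℝ 2 ((volume : Measure (RN N)).restrict Ω)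

/-- `L²(Ω; ℝ^N)`. -/
abbrev L2Vec {N : ℕ} (Ω : Set (RN N)) : Type :=
  Lp (RN N) 2 ((volume : Measure (RN N)).restrict Ω)

theorem IsTestFun.memLp {N : ℕ} {Ω : Set (RN N)} {φ : RN N → ℝ} (hφ : IsTestFun Ω φ) :
    MemLp φ 2 ((volume : Measure (RN N)).restrict Ω) :=
  (hφ.1.continuous.memLp_of_hasCompactSupport hφ.2.1).restrict Ω

theorem IsTestFun.memLp_partialDeriv {N : ℕ} {Ω : Set (RN N)} {φ : RN N → ℝ}
    (hφ : IsTestFun Ω φ) (i : Fin N) :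
    MemLp (partialDeriv i φ) 2 ((volume : Measure (RN N)).restrict Ω) := by
  have hc : Continuous (partialDeriv i φ) :=
    (hφ.1.continuous_fderiv (by simp)).clm_apply continuous_const
  have hs : HasCompactSupport (partialDeriv i φ) := hφ.2.1.fderiv_apply ℝ _
  exact (hc.memLp_of_hasCompactSupport hs).restrict Ω

theorem memLp_coord {N : ℕ} {Ω : Set (RN N)} (g : L2Vec Ω) (i : Fin N) :
    MemLp (fun x => g x i) 2 ((volume : Measure (RN N)).restrict Ω) :=
  (Lp.memLp g).continuousLinearMap_comp (EuclideanSpace.proj (𝕜 := ℝ) i)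

/-- The Sobolev space `H¹(Ω)`: the functions `f ∈ L²(Ω)` that have a weak gradient
`g ∈ L²(Ω; ℝ^N)`. An element is stored as the pair `(f, g)`, where `g` is determined by `f`
when `Ω` is open; the norm is `(‖f‖₂² + ‖∇f‖₂²)^{1/2}`. -/
def H1 {N : ℕ} (Ω : Set (RN N)) : Submodule ℝ (WithLp 2 (L2 Ω × L2Vec Ω)) where
  carrier := {p | IsWeakGradient Ω (p.fst : RN N → ℝ) (p.snd : RN N → RN N)}
  zero_mem' := by
    intro φ _ i
    have h1 : ∫ x in Ω, (0 : L2 Ω) x * partialDeriv i φ x = 0 := by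
      refine integral_eq_zero_of_ae ?_
      filter_upwards [Lp.coeFn_zero ℝ 2 ((volume : Measure (RN N)).restrict Ω)] with x hx
      rw [hx]
      simp
    have h2 : ∫ x in Ω, (0 : L2Vec Ω) x i * φ x = 0 := by
      refine integral_eq_zero_of_ae ?_
      filter_upwards [Lp.coeFn_zero (RN N) 2 ((volume : Measure (RN N)).restrict Ω)] with x hx
      rw [hx]
      simp
    change ∫ x in Ω, (0 : L2 Ω) x * partialDeriv i φ x
      = - ∫ x in Ω, (0 : L2Vec Ω) x i * φ x
    rw [h1, h2, neg_zero]
  add_mem' := by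
    intro p q hp hq φ hφ i
    have h1 : ∫ x in Ω, (p.fst + q.fst : L2 Ω) x * partialDeriv i φ x
        = (∫ x in Ω, p.fst x * partialDeriv i φ x)
          + ∫ x in Ω, q.fst x * partialDeriv i φ x := by
      refine Eq.trans ?_ (integral_add ((Lp.memLp p.fst).integrable_mul (hφ.memLp_partialDeriv i))
        ((Lp.memLp q.fst).integrable_mul (hφ.memLp_partialDeriv i)))
      refine integral_congr_ae ?_
      filter_upwards [Lp.coeFn_add p.fst q.fst] with x hx
      rw [hx]
      simp [add_mul]
    have h2 : ∫ x in Ω, (p.snd + q.snd : L2Vec Ω) x i * φ x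
        = (∫ x in Ω, p.snd x i * φ x) + ∫ x in Ω, q.snd x i * φ x := by
      refine Eq.trans ?_ (integral_add ((memLp_coord p.snd i).integrable_mul hφ.memLp)
        ((memLp_coord q.snd i).integrable_mul hφ.memLp))
      refine integral_congr_ae ?_
      filter_upwards [Lp.coeFn_add p.snd q.snd] with x hx
      rw [hx]
      simp [add_mul]
    have hp' := hp φ hφ i
    have hq' := hq φ hφ i
    change ∫ x in Ω, (p.fst + q.fst : L2 Ω) x * partialDeriv i φ x
      = - ∫ x in Ω, (p.snd + q.snd : L2Vec Ω) x i * φ x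
    rw [h1, h2, hp', hq']
    ring
  smul_mem' := by
    intro c p hp φ hφ i
    have h1 : ∫ x in Ω, (c • p.fst : L2 Ω) x * partialDeriv i φ x
        = c * ∫ x in Ω, p.fst x * partialDeriv i φ x := by
      rw [← integral_const_mul]
      refine integral_congr_ae ?_
      filter_upwards [Lp.coeFn_smul c p.fst] with x hx
      simp [hx, mul_assoc]
    have h2 : ∫ x in Ω, (c • p.snd : L2Vec Ω) x i * φ x
        = c * ∫ x in Ω, p.snd x i * φ x := by
      rw [← integral_const_mul]
      refine integral_congr_ae ?_
      filter_upwards [Lp.coeFn_smul c p.snd] with x hx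
      simp [hx, mul_assoc]
    have hp' := hp φ hφ i
    change ∫ x in Ω, (c • p.fst : L2 Ω) x * partialDeriv i φ x
      = - ∫ x in Ω, (c • p.snd : L2Vec Ω) x i * φ x
    rw [h1, h2, hp']
    ring

/-- The inclusion `H¹(Ω) → L²(Ω)`. -/
def H1.toL2 {N : ℕ} (Ω : Set (RN N)) : H1 Ω →L[ℝ] L2 Ω :=
  (WithLp.fstL 2 ℝ (L2 Ω) (L2Vec Ω)).comp (H1 Ω).subtypeL

/-- The weak gradient `H¹(Ω) → L²(Ω; ℝ^N)`. -/
def H1.grad {N : ℕ} (Ω : Set (RN N)) : H1 Ω →L[ℝ] L2Vec Ω :=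
  (WithLp.sndL 2 ℝ (L2 Ω) (L2Vec Ω)).comp (H1 Ω).subtypeL

/-- The (quasi-)norm `‖f‖_p` on `Ω` for `0 < p < ∞`, with value `∞` if `f ∉ L^p(Ω)`. -/
def normOn {N : ℕ} (Ω : Set (RN N)) (p : ℝ) (f : RN N → ℝ) : ℝ≥0∞ :=
  eLpNorm f (ENNReal.ofReal p) ((volume : Measure (RN N)).restrict Ω)

/-- The critical Sobolev exponent `2N/(N-2)`, used only for `N ≥ 3`. -/
def sobolevExponent (N : ℕ) : ℝ := 2 * (N : ℝ) / ((N : ℝ) - 2)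

/-- The interpolation exponent `ϑ(s,r,N) = 2N(r-s) / (r[2N-s(N-2)])`. -/
def gnsTheta (s r : ℝ) (N : ℕ) : ℝ :=
  2 * (N : ℝ) * (r - s) / (r * (2 * (N : ℝ) - s * ((N : ℝ) - 2)))

/-- The admissible pairs `(s,r)`: `0 < s < r < ∞` if `N ≤ 2`, and
`0 < s < r ≤ 2N/(N-2)` or `2N/(N-2) ≤ r < s < ∞` if `N ≥ 3`. -/
def GNSAdmissible (N : ℕ) (s r : ℝ) : Prop :=
  (N ≤ 2 ∧ 0 < s ∧ s < r) ∨
  (3 ≤ N ∧ ((0 < s ∧ s < r ∧ r ≤ sobolevExponent N) ∨ (sobolevExponent N ≤ r ∧ r < s)))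

/-- `Ω` supports the Gagliardo-Nirenberg-Sobolev inequalities: for all admissible `(s,r)`,
`‖f‖_r ≤ C_S (‖∇f‖₂ + ‖f‖₂)^ϑ ‖f‖_s^{1-ϑ}` for all `f ∈ H¹(Ω) ∩ L^s(Ω)`,
where `C_S = C_S(s,r) > 0` is bounded as long as `s, r` range in compact subsets of `(0,∞)`. -/
def SupportsGNS {N : ℕ} (Ω : Set (RN N)) : Prop :=
  ∃ C_S : ℝ → ℝ → ℝ,
    (∀ K : Set ℝ, IsCompact K → K ⊆ Set.Ioi 0 →
      ∃ M : ℝ, ∀ s ∈ K, ∀ r ∈ K, GNSAdmissible N s r → C_S s r ≤ M) ∧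
    ∀ s r : ℝ, GNSAdmissible N s r → 0 < C_S s r ∧
      ∀ f : H1 Ω, normOn Ω s (H1.toL2 Ω f) < ⊤ →
        normOn Ω r (H1.toL2 Ω f) ≤
          ENNReal.ofReal (C_S s r)
            * ENNReal.ofReal (‖H1.grad Ω f‖ + ‖H1.toL2 Ω f‖) ^ gnsTheta s r N
            * normOn Ω s (H1.toL2 Ω f) ^ (1 - gnsTheta s r N)

/-- The mean value `(∫_Ω f) / |Ω|`. -/
def meanOn {N : ℕ} (Ω : Set (RN N)) (f : RN N → ℝ) : ℝ :=
  (∫ x in Ω, f x) / (volume : Measure (RN N)).real Ω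

/-- The Poincaré inequality on `Ω`: for some `C_P > 0`,
`‖f - f̄‖₂ ≤ C_P ‖∇f‖₂` for all `f ∈ H¹(Ω)`. -/
def SupportsPoincare {N : ℕ} (Ω : Set (RN N)) : Prop :=
  ∃ C_P : ℝ, 0 < C_P ∧ ∀ f : H1 Ω,
    normOn Ω 2 (fun x => H1.toL2 Ω f x - meanOn Ω (H1.toL2 Ω f))
      ≤ ENNReal.ofReal (C_P * ‖H1.grad Ω f‖)

end

/-!
The Gagliardo–Nirenberg–Sobolev inequality with `s = 2` bounds `‖f‖_q` by the `H¹` norm for some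
`q > 2`. By Hölder's inequality, the `L²` mass of `f` on a thin layer along `∂Ω` is then uniformly
small on the unit ball of `H¹`, because `|Ω| < ∞`. Away from that layer, mollification at scale `δ`
moves `f` by at most `δ ‖∇f‖₂` in `L²`, and it is a Hilbert–Schmidt operator. So the inclusion
`H¹ → L²` is a norm limit of compact operators. By Peetre's lemma, `‖∇f‖₂` then controls the `H¹`
distance from `f` to the kernel of `∇`, which on a domain consists of constants; the mean is the
best constant approximation in `L²`.
-/

open Filter Set Topology
open scoped NNReal Convolution

theorem isCompactOperator_of_forall_exists_enorm_sub_le {𝕜 E F : Type*} [NontriviallyNormedField 𝕜]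
    [NormedAddCommGroup E] [NormedSpace 𝕜 E] [NormedAddCommGroup F] [NormedSpace 𝕜 F]
    [CompleteSpace F] {T : E →L[𝕜] F}
    (h : ∀ ε : ℝ≥0, 0 < ε → ∃ S : E →L[𝕜] F,
      IsCompactOperator S ∧ ∀ x, ‖T x - S x‖ₑ ≤ ε * ‖x‖ₑ) :
    IsCompactOperator T := by
  refine isClosed_setOfPred_isCompactOperator.closure_subset
    (Metric.mem_closure_iff.mpr fun ε hε => ?_)
  lift ε to ℝ≥0 using hε.le
  obtain ⟨S, hS, hTS⟩ := h (ε / 2) (half_pos (mod_cast hε))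
  refine ⟨S, hS, lt_of_le_of_lt ?_ (half_lt_self hε)⟩
  rw [dist_eq_norm]
  refine ContinuousLinearMap.opNorm_le_bound _ (by positivity) fun x => ?_
  simpa using ENNReal.toReal_mono (by finiteness) (hTS x)

/-- Peetre's lemma for injective operators. -/
theorem exists_norm_le_mul_norm_of_injective {𝕜 E F G : Type*} [RCLike 𝕜]
    [NormedAddCommGroup E] [NormedSpace 𝕜 E] [CompleteSpace E]
    [NormedAddCommGroup F] [NormedSpace 𝕜 F] [NormedAddCommGroup G] [NormedSpace 𝕜 G]
    {T : E →L[𝕜] F} {D : E →L[𝕜] G} (hT : IsCompactOperator T) (hD : Function.Injective D)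
    (hTD : ∀ x, ‖x‖ ≤ ‖T x‖ + ‖D x‖) :
    ∃ C : ℝ, 0 < C ∧ ∀ x, ‖x‖ ≤ C * ‖D x‖ := by
  by_contra! hcon
  choose x hx using fun n : ℕ => hcon (n + 1) n.cast_add_one_pos
  have hx0 (n : ℕ) : 0 < ‖x n‖ := lt_of_le_of_lt (by positivity) (hx n)
  set y : ℕ → E := fun n => ((‖x n‖⁻¹ : ℝ) : 𝕜) • x n with hy
  have norm_y (n : ℕ) : ‖y n‖ = 1 := by
    simpa [hy] using norm_smul_inv_norm (𝕜 := 𝕜) (norm_pos_iff.mp (hx0 n))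
  have norm_Dy (n : ℕ) : ‖D (y n)‖ ≤ 1 / ((n : ℝ) + 1) := by
    have : ‖D (y n)‖ = ‖x n‖⁻¹ * ‖D (x n)‖ := by simp [hy, norm_smul]
    rw [this, inv_mul_le_iff₀ (hx0 n), mul_one_div, le_div_iff₀ (by positivity), mul_comm]
    exact (hx n).le
  have tendsto_Dy : Tendsto (fun n => D (y n)) atTop (𝓝 0) :=
    squeeze_zero_norm norm_Dy tendsto_one_div_add_atTop_nhds_zero_nat
  obtain ⟨K, hK, hKT⟩ := IsCompactOperator.image_closedBall_subset_compact
    (f := (T : E →ₗ[𝕜] F)) hT 1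
  obtain ⟨_, -, ψ, hψ, hTy⟩ := hK.tendsto_subseq (x := fun n => T (y n))
    fun n => hKT ⟨y n, by simp [norm_y], rfl⟩
  have hDy : Tendsto (fun n => D (y (ψ n))) atTop (𝓝 0) := tendsto_Dy.comp hψ.tendsto_atTop
  have hcauchy : CauchySeq fun n => y (ψ n) := by
    have hlim := (cauchySeq_iff_tendsto_dist_atTop_0.mp hTy.cauchySeq).add
      (cauchySeq_iff_tendsto_dist_atTop_0.mp hDy.cauchySeq)
    rw [add_zero] at hlim
    refine cauchySeq_iff_tendsto_dist_atTop_0.mpr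
      (squeeze_zero (fun _ => dist_nonneg) (fun n => ?_) hlim)
    simpa only [dist_eq_norm, Function.comp_apply, map_sub] using hTD (y (ψ n.1) - y (ψ n.2))
  obtain ⟨z, hz⟩ := cauchySeq_tendsto_of_complete hcauchy
  have hDz : D z = D 0 := by
    simpa using tendsto_nhds_unique ((D.continuous.tendsto z).comp hz) hDy
  have norm_z : ‖z‖ = 1 := tendsto_nhds_unique hz.norm (by simp [norm_y])
  simp [hD hDz] at norm_z

/-- Peetre's lemma: an operator that controls the norm up to a compact operator controls the
distance to its kernel. -/
theorem exists_norm_sub_starProjection_ker_le {𝕜 E F G : Type*} [RCLike 𝕜]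
    [NormedAddCommGroup E] [InnerProductSpace 𝕜 E] [CompleteSpace E]
    [NormedAddCommGroup F] [NormedSpace 𝕜 F] [NormedAddCommGroup G] [NormedSpace 𝕜 G]
    {T : E →L[𝕜] F} {D : E →L[𝕜] G} (hT : IsCompactOperator T)
    (hTD : ∀ x, ‖x‖ ≤ ‖T x‖ + ‖D x‖) :
    ∃ C : ℝ, 0 < C ∧ ∀ x, ‖x - D.ker.starProjection x‖ ≤ C * ‖D x‖ := by
  have hinj : Function.Injective (D ∘L D.kerᗮ.subtypeL) := by
    refine (injective_iff_map_eq_zero _).mpr fun x hx => ?_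
    exact Subtype.ext (Submodule.disjoint_def.mp D.ker.orthogonal_disjoint _ hx x.2)
  obtain ⟨C, hC, h⟩ := exists_norm_le_mul_norm_of_injective (T := T ∘L D.kerᗮ.subtypeL)
    (hT.comp_clm D.kerᗮ.subtypeL) hinj fun x => hTD x
  refine ⟨C, hC, fun x => ?_⟩
  have hproj : D (D.ker.starProjection x) = 0 := D.ker.starProjection_apply_mem x
  simpa [hproj] using h ⟨_, D.ker.sub_starProjection_mem_orthogonal x⟩

/-- The Hilbert–Schmidt operator `v ↦ (x ↦ ⟪v, K x⟫)` with kernel `K`. -/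
noncomputable def kernelOperator {α : Type*} [MeasurableSpace α] (μ : Measure α) (p : ℝ≥0∞)
    [Fact (1 ≤ p)] (E : Type*) [NormedAddCommGroup E] [InnerProductSpace ℝ E] :
    Lp E p μ →L[ℝ] E →L[ℝ] Lp ℝ p μ :=
  ((innerSL ℝ : E →L[ℝ] E →L[ℝ] ℝ).compLpL₂ p μ).flip

section KernelOperator

variable {α : Type*} [MeasurableSpace α] {μ : Measure α} {p : ℝ≥0∞} [Fact (1 ≤ p)]
  {E : Type*} [NormedAddCommGroup E] [InnerProductSpace ℝ E]

theorem coeFn_kernelOperator (K : Lp E p μ) (v : E) :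
    kernelOperator μ p E K v =ᵐ[μ] fun x => inner ℝ v (K x) :=
  ContinuousLinearMap.coeFn_compLp (innerSL ℝ v) K

theorem kernelOperator_indicatorConstLp {s : Set α} (hs : MeasurableSet s) (hμs : μ s ≠ ⊤) (c : E) :
    kernelOperator μ p E (indicatorConstLp p hs hμs c) =
      ContinuousLinearMap.toSpanSingleton ℝ (indicatorConstLp p hs hμs (1 : ℝ)) ∘L innerSL ℝ c := by
  ext1 v
  refine Lp.ext ?_
  filter_upwards [coeFn_kernelOperator (indicatorConstLp p hs hμs c) v,
    indicatorConstLp_coeFn (p := p) (hs := hs) (hμs := hμs) (c := c),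
    indicatorConstLp_coeFn (p := p) (hs := hs) (hμs := hμs) (c := (1 : ℝ)),
    Lp.coeFn_smul (innerSL ℝ c v) (indicatorConstLp p hs hμs (1 : ℝ))] with x h1 h2 h3 h4
  rw [h1, h2, ContinuousLinearMap.comp_apply, ContinuousLinearMap.toSpanSingleton_apply, h4,
    Pi.smul_apply, h3]
  by_cases hx : x ∈ s <;> simp [hx, real_inner_comm]

theorem isCompactOperator_kernelOperator (hp : p ≠ ⊤) (K : Lp E p μ) :
    IsCompactOperator (kernelOperator μ p E K) := by
  refine Lp.induction hp (motive := fun K => IsCompactOperator (kernelOperator μ p E K))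
    (fun c s hs hμs => ?_) (fun f g hf hg _ h1 h2 => ?_)
    (isClosed_setOfPred_isCompactOperator.preimage (kernelOperator μ p E).continuous) K
  · rw [Lp.simpleFunc.coe_indicatorConst, kernelOperator_indicatorConstLp]
    exact (isCompactOperator_of_locallyCompactSpace_rng (ContinuousLinearMap.toSpanSingleton ℝ
      (indicatorConstLp p hs hμs.ne (1 : ℝ)))).comp_clm (innerSL ℝ c)
  · rw [map_add]
    exact h1.add h2

end KernelOperator

/-- A form of Minkowski's integral inequality. -/
theorem eLpNorm_le_of_enorm_le_lintegral {α β G : Type*} [MeasurableSpace α] [MeasurableSpace β]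
    [NormedAddCommGroup G] {μ : Measure α} [SFinite μ] {ν : Measure β} [IsProbabilityMeasure ν]
    {p : ℝ≥0∞} (hp : 1 ≤ p) (hp' : p ≠ ⊤) {u : α → G} {h : α → β → ℝ≥0∞}
    (hm : Measurable (Function.uncurry h)) (hu : ∀ᵐ x ∂μ, ‖u x‖ₑ ≤ ∫⁻ b, h x b ∂ν)
    {M : ℝ≥0∞} (hM : ∀ᵐ b ∂ν, eLpNorm (fun x => h x b) p μ ≤ M) :
    eLpNorm u p μ ≤ M := by
  have hp0 : p ≠ 0 := (one_pos.trans_le hp).ne'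
  have hr : 0 < p.toReal := ENNReal.toReal_pos hp0 hp'
  have jensen (x : α) : (∫⁻ b, h x b ∂ν) ^ p.toReal ≤ ∫⁻ b, h x b ^ p.toReal ∂ν := by
    have := eLpNorm_le_eLpNorm_of_exponent_le (μ := ν) hp
      (hm.comp measurable_prodMk_left : Measurable (h x)).aestronglyMeasurable
    rw [eLpNorm_one_eq_lintegral_enorm, eLpNorm_eq_lintegral_rpow_enorm_toReal hp0 hp', one_div,
      ENNReal.le_rpow_inv_iff hr] at this
    simpa only [enorm_eq_self, Function.comp_apply, Function.uncurry_apply_pair] using this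
  have hMb : ∀ᵐ b ∂ν, ∫⁻ x, h x b ^ p.toReal ∂μ ≤ M ^ p.toReal := by
    filter_upwards [hM] with b hb
    rwa [eLpNorm_eq_lintegral_rpow_enorm_toReal hp0 hp', one_div, ENNReal.rpow_inv_le_iff hr] at hb
  rw [eLpNorm_eq_lintegral_rpow_enorm_toReal hp0 hp', one_div, ENNReal.rpow_inv_le_iff hr]
  calc ∫⁻ x, ‖u x‖ₑ ^ p.toReal ∂μ
      ≤ ∫⁻ x, ∫⁻ b, h x b ^ p.toReal ∂ν ∂μ := by
        refine lintegral_mono_ae ?_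
        filter_upwards [hu] with x hx
        exact (ENNReal.rpow_le_rpow hx hr.le).trans (jensen x)
    _ = ∫⁻ b, ∫⁻ x, h x b ^ p.toReal ∂μ ∂ν :=
        lintegral_lintegral_swap (hm.pow_const p.toReal).aemeasurable
    _ ≤ ∫⁻ _, M ^ p.toReal ∂ν := lintegral_mono_ae hMb
    _ = M ^ p.toReal := by simp

theorem eLpNorm_restrict_le_mul_rpow_measure {α G : Type*} [MeasurableSpace α]
    [NormedAddCommGroup G] {μ : Measure α} {p q : ℝ≥0∞} (hpq : p ≤ q) {f : α → G}
    (hf : AEStronglyMeasurable f μ) (A : Set α) :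
    eLpNorm f p (μ.restrict A) ≤ eLpNorm f q μ * μ A ^ (1 / p.toReal - 1 / q.toReal) := by
  refine (eLpNorm_le_eLpNorm_mul_rpow_measure_univ hpq hf.restrict).trans ?_
  rw [Measure.restrict_apply_univ]
  gcongr
  exact Measure.restrict_le_self

theorem eLpNorm_le_eLpNorm_restrict_add {α G : Type*} [MeasurableSpace α] [NormedAddCommGroup G]
    {μ : Measure α} {p : ℝ≥0∞} {f : α → G} (hf : AEStronglyMeasurable f μ) {A : Set α}
    (hA : MeasurableSet A) (hp : 1 ≤ p) :
    eLpNorm f p μ ≤ eLpNorm f p (μ.restrict A) + eLpNorm f p (μ.restrict Aᶜ) := by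
  rw [← eLpNorm_indicator_eq_eLpNorm_restrict hA, ← eLpNorm_indicator_eq_eLpNorm_restrict hA.compl]
  nth_rw 1 [← indicator_self_add_compl A f]
  exact eLpNorm_add_le (hf.indicator hA) (hf.indicator hA.compl) hp

/-- The fundamental theorem of calculus along the segments `[x - z, x]`, in `L^p`. -/
theorem eLpNorm_translate_sub_le_of_fderiv {E G : Type*} [NormedAddCommGroup E] [NormedSpace ℝ E]
    [MeasurableSpace E] [BorelSpace E] [NormedAddCommGroup G]
    [NormedSpace ℝ G] {μ : Measure E} [SFinite μ] {p : ℝ≥0∞} (hp : 1 ≤ p) (hp' : p ≠ ⊤)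
    {u : E → G} (hu : ContDiff ℝ 1 u) (z : E) {M : ℝ≥0∞}
    (hM : ∀ t ∈ Icc (0 : ℝ) 1, eLpNorm (fun x => fderiv ℝ u (x - t • z) z) p μ ≤ M) :
    eLpNorm (fun x => u (x - z) - u x) p μ ≤ M := by
  have hprob : IsProbabilityMeasure (volume.restrict (Icc (0 : ℝ) 1)) := ⟨by simp⟩
  have hcont : Continuous fun q : E × ℝ => fderiv ℝ u (q.1 - q.2 • z) z :=
    ((hu.continuous_fderiv one_ne_zero).comp (by fun_prop)).clm_apply continuous_const
  refine eLpNorm_le_of_enorm_le_lintegral (ν := volume.restrict (Icc (0 : ℝ) 1)) hp hp'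
    (h := fun x t => ‖fderiv ℝ u (x - t • z) z‖ₑ) hcont.enorm.measurable
    (Eventually.of_forall fun x => ?_) ?_
  · have hderiv (t : ℝ) :
        HasDerivAt (fun t : ℝ => u (x - t • z)) (-fderiv ℝ u (x - t • z) z) t := by
      have hline : HasDerivAt (fun t : ℝ => x - t • z) (-z) t := by
        simpa using ((hasDerivAt_id t).smul_const z).const_sub x
      simpa [Function.comp_def] using
        (hu.differentiable one_ne_zero _).hasFDerivAt.comp_hasDerivAt t hline
    have hcurve : ContDiff ℝ 1 fun t : ℝ => u (x - t • z) := by fun_prop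
    simpa [(hderiv _).deriv] using
      enorm_sub_le_lintegral_deriv_of_contDiffOn_Icc hcurve.contDiffOn zero_le_one
  · filter_upwards [ae_restrict_mem measurableSet_Icc] with t ht
    simpa only [eLpNorm_enorm] using hM t ht

section Mollification

variable {E : Type*} [NormedAddCommGroup E] [NormedSpace ℝ E] [HasContDiffBump E]
  [MeasurableSpace E] {V : Type*} [NormedAddCommGroup V] [NormedSpace ℝ V]

/-- The mollification `φ ⋆ F`, where the bump function `φ` is normalized to have integral `1`. -/
noncomputable def mollify (μ : Measure E) (φ : ContDiffBump (0 : E)) (F : E → V) : E → V :=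
  φ.normed μ ⋆[ContinuousLinearMap.lsmul ℝ ℝ, μ] F

/-- The probability measure with density the normalized bump function `φ`, so that `φ ⋆ F` is an
average of translates of `F`. -/
noncomputable def bumpMeasure (μ : Measure E) (φ : ContDiffBump (0 : E)) : Measure E :=
  μ.withDensity fun w => ENNReal.ofReal (φ.normed μ w)

variable [BorelSpace E] {μ : Measure E}

theorem mollify_eq_integral_bumpMeasure (φ : ContDiffBump (0 : E)) (F : E → V) (x : E) :
    mollify μ φ F x = ∫ w, F (x - w) ∂bumpMeasure μ φ := by
  rw [bumpMeasure, integral_withDensity_eq_integral_toReal_smul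
    φ.continuous_normed.measurable.ennreal_ofReal (Eventually.of_forall fun _ => by finiteness)]
  simp only [ENNReal.toReal_ofReal (φ.nonneg_normed _)]
  rfl

variable [FiniteDimensional ℝ E] [μ.IsAddHaarMeasure]

theorem contDiff_mollify (φ : ContDiffBump (0 : E)) {F : E → V}
    (hF : LocallyIntegrable F μ) : ContDiff ℝ 1 (mollify μ φ F) :=
  φ.hasCompactSupport_normed.contDiff_convolution_left _ (φ.contDiff_normed (n := 1)) hF

instance isProbabilityMeasure_bumpMeasure (φ : ContDiffBump (0 : E)) :
    IsProbabilityMeasure (bumpMeasure μ φ) where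
  measure_univ := by
    rw [bumpMeasure, withDensity_apply _ MeasurableSet.univ, Measure.restrict_univ,
      ← ofReal_integral_eq_lintegral_ofReal φ.integrable_normed
        (Eventually.of_forall φ.nonneg_normed), φ.integral_normed, ENNReal.ofReal_one]

theorem ae_bumpMeasure_norm_le (φ : ContDiffBump (0 : E)) :
    ∀ᵐ w ∂bumpMeasure μ φ, ‖w‖ ≤ φ.rOut := by
  rw [bumpMeasure, ae_withDensity_iff φ.continuous_normed.measurable.ennreal_ofReal]
  refine Eventually.of_forall fun w hw => ?_
  have hsupp : w ∈ Function.support (φ.normed μ) := fun h => hw (by simp [h])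
  rw [φ.support_normed_eq] at hsupp
  exact (mem_ball_zero_iff.mp hsupp).le

theorem integrable_bumpMeasure (φ : ContDiffBump (0 : E)) {F : E → V}
    (hF : LocallyIntegrable F μ) (x : E) : Integrable (fun w => F (x - w)) (bumpMeasure μ φ) := by
  rw [bumpMeasure, integrable_withDensity_iff_integrable_smul'
    φ.continuous_normed.measurable.ennreal_ofReal (Eventually.of_forall fun _ => by finiteness)]
  simp only [ENNReal.toReal_ofReal (φ.nonneg_normed _)]
  exact φ.hasCompactSupport_normed.convolutionExists_left (ContinuousLinearMap.lsmul ℝ ℝ)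
    φ.continuous_normed hF x

theorem enorm_mollify_sub_le [CompleteSpace V] (φ : ContDiffBump (0 : E)) {F : E → V}
    (hF : LocallyIntegrable F μ) (x : E) :
    ‖mollify μ φ F x - F x‖ₑ ≤ ∫⁻ w, ‖F (x - w) - F x‖ₑ ∂bumpMeasure μ φ := by
  have h : mollify μ φ F x - F x = ∫ w, F (x - w) - F x ∂bumpMeasure μ φ := by
    rw [integral_sub (integrable_bumpMeasure φ hF x) (integrable_const _), integral_const,
      probReal_univ, one_smul, mollify_eq_integral_bumpMeasure]
  exact h ▸ enorm_integral_le_lintegral_enorm _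

theorem eLpNorm_mollify_le {p : ℝ≥0∞} (hp : 1 ≤ p) (hp' : p ≠ ⊤) (φ : ContDiffBump (0 : E))
    {F : E → V} (hF : StronglyMeasurable F) : eLpNorm (mollify μ φ F) p μ ≤ eLpNorm F p μ := by
  refine eLpNorm_le_of_enorm_le_lintegral (ν := bumpMeasure μ φ) hp hp'
    (h := fun x w => ‖F (x - w)‖ₑ) (hF.enorm.comp measurable_sub)
    (Eventually.of_forall fun x => ?_) (Eventually.of_forall fun w => le_of_eq ?_)
  · rw [mollify_eq_integral_bumpMeasure]
    exact enorm_integral_le_lintegral_enorm _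
  · rw [eLpNorm_enorm]
    exact eLpNorm_comp_measurePreserving hF.aestronglyMeasurable (measurePreserving_sub_right μ w)

theorem exists_bump_seq_ae_tendsto_mollify [CompleteSpace V] {δ : ℝ} (hδ : 0 < δ) {F : E → V}
    (hF : LocallyIntegrable F μ) :
    ∃ φ : ℕ → ContDiffBump (0 : E), (∀ n, (φ n).rOut ≤ δ) ∧
      ∀ᵐ x ∂μ, Tendsto (fun n => mollify μ (φ n) F x) atTop (𝓝 (F x)) := by
  have hpos (n : ℕ) : 0 < δ / (n + 1) := by positivity
  let φ (n : ℕ) : ContDiffBump (0 : E) :=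
    ⟨δ / (n + 1) / 2, δ / (n + 1), half_pos (hpos n), half_lt_self (hpos n)⟩
  have hlim : Tendsto (fun n => (φ n).rOut) atTop (𝓝 0) := by
    simpa [φ, div_eq_mul_inv] using
      (tendsto_one_div_add_atTop_nhds_zero_nat (𝕜 := ℝ)).const_mul δ
  refine ⟨φ, fun n => div_le_self hδ.le (by simp), ?_⟩
  exact ContDiffBump.ae_convolution_tendsto_right_of_locallyIntegrable (K := 2) hlim
    (Eventually.of_forall fun n => (mul_div_cancel₀ _ two_ne_zero).ge) hF

end Mollification

section WeakGradient

variable {N : ℕ} {Ω : Set (RN N)} {F : RN N → ℝ} {G : RN N → RN N}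

theorem IsWeakGradient.integral_smul_fderiv (hw : IsWeakGradient Ω F G) (hF : LocallyIntegrable F)
    (hG : LocallyIntegrable G) {ζ : RN N → ℝ} (hζ : IsTestFun Ω ζ) :
    ∫ x, F x • fderiv ℝ ζ x = -innerSL ℝ (∫ x, ζ x • G x) := by
  obtain ⟨hsmooth, hsupp, hΩ⟩ := hζ
  have hF' : Integrable fun x => F x • fderiv ℝ ζ x :=
    hF.integrable_smul_right_of_hasCompactSupport (hsmooth.continuous_fderiv (by simp))
      (hsupp.fderiv ℝ)
  have hG' : Integrable fun x => ζ x • G x :=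
    hG.integrable_smul_left_of_hasCompactSupport hsmooth.continuous hsupp
  have hζ0 {x : RN N} (hx : x ∉ Ω) : ζ x = 0 := image_eq_zero_of_notMem_tsupport fun h => hx (hΩ h)
  have hdζ0 {x : RN N} (hx : x ∉ Ω) : fderiv ℝ ζ x = 0 :=
    Function.notMem_support.mp fun h => hx (hΩ (support_fderiv_subset ℝ h))
  refine ContinuousLinearMap.coe_injective
    ((EuclideanSpace.basisFun (Fin N) ℝ).toBasis.ext fun i => ?_)
  have hi : (∫ x, ζ x • G x) i = ∫ x, ζ x * G x i :=
    ((EuclideanSpace.proj i).integral_comp_comm hG').symm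
  have := hw ζ ⟨hsmooth, hsupp, hΩ⟩ i
  rw [setIntegral_eq_integral_of_forall_compl_eq_zero fun x hx => by simp [partialDeriv, hdζ0 hx],
    setIntegral_eq_integral_of_forall_compl_eq_zero fun x hx => by simp [hζ0 hx]] at this
  simpa [ContinuousLinearMap.integral_apply hF', EuclideanSpace.inner_single_right, hi,
    partialDeriv, mul_comm] using this

theorem isTestFun_normed_sub (φ : ContDiffBump (0 : RN N)) {x : RN N}
    (hx : Metric.closedBall x φ.rOut ⊆ Ω) : IsTestFun Ω fun y => φ.normed volume (x - y) := by
  have hs : Function.support (fun y => φ.normed volume (x - y)) ⊆ Metric.closedBall x φ.rOut := by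
    intro y hy
    have hxy : x - y ∈ Function.support (φ.normed volume) := hy
    rw [φ.support_normed_eq, mem_ball_zero_iff] at hxy
    exact mem_closedBall_iff_norm'.mpr hxy.le
  have hts := closure_minimal hs Metric.isClosed_closedBall
  exact ⟨φ.contDiff_normed.comp (contDiff_const.sub contDiff_id),
    (isCompact_closedBall x φ.rOut).of_isClosed_subset (isClosed_tsupport _) hts, hts.trans hx⟩

theorem IsWeakGradient.fderiv_mollify (hw : IsWeakGradient Ω F G) (hF : LocallyIntegrable F)
    (hG : LocallyIntegrable G) (φ : ContDiffBump (0 : RN N)) {x : RN N}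
    (hx : Metric.closedBall x φ.rOut ⊆ Ω) :
    fderiv ℝ (mollify volume φ F) x = innerSL ℝ (mollify volume φ G x) := by
  have hderiv (y : RN N) : fderiv ℝ (fun y => φ.normed volume (x - y)) y =
      -fderiv ℝ (φ.normed volume) (x - y) := by
    have hψ : DifferentiableAt ℝ (φ.normed volume) (x - y) :=
      (φ.contDiff_normed (n := 1)).differentiable one_ne_zero _
    simpa [Function.comp_def] using
      (hψ.hasFDerivAt.comp y ((hasFDerivAt_id y).const_sub x)).fderiv
  calc fderiv ℝ (mollify volume φ F) x
      = (fderiv ℝ (φ.normed volume) ⋆[(ContinuousLinearMap.lsmul ℝ ℝ).precompL (RN N), volume]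
          F) x :=
        (φ.hasCompactSupport_normed.hasFDerivAt_convolution_left _
          (φ.contDiff_normed (n := 1)) hF x).fderiv
    _ = -∫ y, F y • fderiv ℝ (fun y => φ.normed volume (x - y)) y := by
        rw [convolution_eq_swap, ← integral_neg]
        refine integral_congr_ae (Eventually.of_forall fun y => ?_)
        ext v
        simp [hderiv, ContinuousLinearMap.precompL_apply, mul_comm]
    _ = innerSL ℝ (∫ y, φ.normed volume (x - y) • G y) := by
        rw [hw.integral_smul_fderiv hF hG (isTestFun_normed_sub φ hx), neg_neg]
    _ = innerSL ℝ (mollify volume φ G x) := by rw [mollify, convolution_eq_swap]; rfl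

end WeakGradient

section WeakGradientEstimates

variable {N : ℕ} {Ω A : Set (RN N)} {F : RN N → ℝ} {G : RN N → RN N} {p : ℝ≥0∞}

theorem IsWeakGradient.eLpNorm_translate_mollify_sub_le (hw : IsWeakGradient Ω F G)
    (hF : LocallyIntegrable F) (hG : LocallyIntegrable G) (hG' : StronglyMeasurable G)
    (hp : 1 ≤ p) (hp' : p ≠ ⊤) (hA : MeasurableSet A) {δ : ℝ}
    (hAΩ : ∀ x ∈ A, Metric.closedBall x (2 * δ) ⊆ Ω) (φ : ContDiffBump (0 : RN N))
    (hφ : φ.rOut ≤ δ) {z : RN N} (hz : ‖z‖ ≤ δ) :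
    eLpNorm (fun x => mollify volume φ F (x - z) - mollify volume φ F x) p (volume.restrict A) ≤
      ‖z‖ₑ * eLpNorm G p volume := by
  refine eLpNorm_translate_sub_le_of_fderiv hp hp' (contDiff_mollify φ hF) z fun t ht => ?_
  have hsub {x : RN N} (hx : x ∈ A) : Metric.closedBall (x - t • z) φ.rOut ⊆ Ω := by
    refine (Metric.closedBall_subset_closedBall' ?_).trans (hAΩ x hx)
    have : ‖t • z‖ ≤ ‖z‖ := by
      rw [norm_smul, Real.norm_of_nonneg ht.1]
      exact mul_le_of_le_one_left (norm_nonneg z) ht.2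
    rw [dist_eq_norm, sub_sub_cancel_left, norm_neg]
    linarith
  calc eLpNorm (fun x => fderiv ℝ (mollify volume φ F) (x - t • z) z) p (volume.restrict A)
      ≤ ENNReal.ofReal ‖z‖ *
          eLpNorm (fun x => mollify volume φ G (x - t • z)) p (volume.restrict A) := by
        refine eLpNorm_le_mul_eLpNorm_of_ae_le_mul ?_ p
        filter_upwards [ae_restrict_mem hA] with x hx
        rw [hw.fderiv_mollify hF hG φ (hsub hx), innerSL_apply_apply, mul_comm]
        exact norm_inner_le_norm _ _
    _ ≤ ENNReal.ofReal ‖z‖ * eLpNorm (fun x => mollify volume φ G (x - t • z)) p volume := by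
        gcongr
        exact Measure.restrict_le_self
    _ = ‖z‖ₑ * eLpNorm (mollify volume φ G) p volume := by
        rw [ofReal_norm]
        congr 1
        exact eLpNorm_comp_measurePreserving
          (contDiff_mollify φ hG).continuous.aestronglyMeasurable
          (measurePreserving_sub_right volume (t • z))
    _ ≤ ‖z‖ₑ * eLpNorm G p volume := by
        gcongr
        exact eLpNorm_mollify_le hp hp' φ hG'

theorem IsWeakGradient.eLpNorm_translate_sub_le (hw : IsWeakGradient Ω F G)
    (hF : LocallyIntegrable F) (hG : LocallyIntegrable G) (hG' : StronglyMeasurable G)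
    (hp : 1 ≤ p) (hp' : p ≠ ⊤) (hA : MeasurableSet A) {δ : ℝ} (hδ : 0 < δ)
    (hAΩ : ∀ x ∈ A, Metric.closedBall x (2 * δ) ⊆ Ω) {z : RN N} (hz : ‖z‖ ≤ δ) :
    eLpNorm (fun x => F (x - z) - F x) p (volume.restrict A) ≤ ‖z‖ₑ * eLpNorm G p volume := by
  obtain ⟨φ, hφ, hlim⟩ := exists_bump_seq_ae_tendsto_mollify hδ hF
  have hcont (n : ℕ) : Continuous (mollify volume (φ n) F) := (contDiff_mollify _ hF).continuous
  refine (Lp.eLpNorm_lim_le_liminf_eLpNorm (f := fun n x =>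
    mollify volume (φ n) F (x - z) - mollify volume (φ n) F x) (fun n => ?_) _ ?_).trans ?_
  · exact (((hcont n).comp (by fun_prop)).sub (hcont n)).aestronglyMeasurable
  · have hlim' := (measurePreserving_sub_right volume z).quasiMeasurePreserving.ae hlim
    filter_upwards [ae_restrict_of_ae hlim, ae_restrict_of_ae hlim'] with x hx hxz
    exact hxz.sub hx
  · exact liminf_le_of_frequently_le' (Frequently.of_forall fun n =>
      hw.eLpNorm_translate_mollify_sub_le hF hG hG' hp hp' hA hAΩ (φ n) (hφ n) hz)

theorem IsWeakGradient.eLpNorm_mollify_sub_le (hw : IsWeakGradient Ω F G)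
    (hF : LocallyIntegrable F) (hF' : StronglyMeasurable F) (hG : LocallyIntegrable G)
    (hG' : StronglyMeasurable G) (hp : 1 ≤ p) (hp' : p ≠ ⊤) (hA : MeasurableSet A)
    (φ : ContDiffBump (0 : RN N)) (hAΩ : ∀ x ∈ A, Metric.closedBall x (2 * φ.rOut) ⊆ Ω) :
    eLpNorm (mollify volume φ F - F) p (volume.restrict A) ≤
      ENNReal.ofReal φ.rOut * eLpNorm G p volume := by
  have hm : Measurable fun q : RN N × RN N => F (q.1 - q.2) - F q.1 :=
    (hF'.measurable.comp measurable_sub).sub (hF'.measurable.comp measurable_fst)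
  refine eLpNorm_le_of_enorm_le_lintegral (ν := bumpMeasure volume φ) hp hp'
    (h := fun x w => ‖F (x - w) - F x‖ₑ) hm.enorm
    (Eventually.of_forall fun x => enorm_mollify_sub_le φ hF x) ?_
  filter_upwards [ae_bumpMeasure_norm_le φ] with w hle
  rw [eLpNorm_enorm]
  refine (hw.eLpNorm_translate_sub_le hF hG hG' hp hp' hA φ.rOut_pos hAΩ hle).trans ?_
  gcongr
  exact (ofReal_norm w).symm.trans_le (ENNReal.ofReal_le_ofReal hle)

end WeakGradientEstimates

theorem neBot_nhds_inf_ae {X : Type*} [TopologicalSpace X] [MeasurableSpace X] (μ : Measure X)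
    [μ.IsOpenPosMeasure] (x : X) : (𝓝 x ⊓ ae μ).NeBot := by
  refine inf_neBot_iff.mpr fun U hU V hV => not_disjoint_iff_nonempty_inter.mp fun hUV => ?_
  exact (Measure.measure_pos_of_mem_nhds μ hU).ne'
    (measure_mono_null hUV.subset_compl_right (mem_ae_iff.mp hV))

theorem exists_ae_eq_const_of_isPreconnected {X Y : Type*} [TopologicalSpace X]
    [SecondCountableTopology X] [MeasurableSpace X] {μ : Measure X} [μ.IsOpenPosMeasure]
    [Nonempty Y] {s : Set X} (hs : IsPreconnected s) {f : X → Y}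
    (hf : ∀ x ∈ s, ∃ c, ∀ᶠ y in 𝓝 x ⊓ ae μ, f y = c) : ∃ c, ∀ᵐ x ∂μ, x ∈ s → f x = c := by
  choose! c hc using hf
  have locally_ae (x : X) (hx : x ∈ s) : ∃ U, IsOpen U ∧ x ∈ U ∧ ∀ᵐ y ∂μ, y ∈ U → f y = c x := by
    obtain ⟨U, hU, V, hV, hUV⟩ := mem_inf_iff_superset.mp (hc x hx)
    obtain ⟨W, hWU, hW, hxW⟩ := mem_nhds_iff.mp hU
    exact ⟨W, hW, hxW, mem_of_superset hV fun y hyV hyW => hUV ⟨hWU hyW, hyV⟩⟩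
  have locally_const (x : X) (hx : x ∈ s) : ∀ᶠ y in 𝓝[s] x, c x = c y := by
    obtain ⟨U, hU, hxU, hfU⟩ := locally_ae x hx
    filter_upwards [self_mem_nhdsWithin, mem_nhdsWithin_of_mem_nhds (hU.mem_nhds hxU)]
      with y hys hyU
    have := neBot_nhds_inf_ae μ y
    obtain ⟨w, hfc, hwU, hfw⟩ := ((hc y hys).and
      (((hU.eventually_mem hyU).filter_mono inf_le_left).and
        (hfU.filter_mono inf_le_right))).exists
    exact (hfw hwU).symm.trans hfc
  rcases s.eq_empty_or_nonempty with rfl | ⟨x₀, hx₀⟩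
  · exact ⟨Classical.arbitrary Y, by simp⟩
  refine ⟨c x₀, ae_iff.mpr (measure_null_of_locally_null _ fun x hx => ?_)⟩
  have hxs : x ∈ s := by_contra fun h => hx fun h' => absurd h' h
  have hcx : c x = c x₀ := hs.induction₂ (fun x y => c x = c y) locally_const
    (fun _ _ _ _ _ _ => Eq.trans) (fun _ _ _ _ => Eq.symm) hxs hx₀
  obtain ⟨U, hU, hxU, hfU⟩ := locally_ae x hxs
  refine ⟨_, inter_mem_nhdsWithin _ (hU.mem_nhds hxU), measure_mono_null ?_ (ae_iff.mp hfU)⟩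
  exact fun y ⟨hy, hyU⟩ hfy => hy fun _ => hcx ▸ hfy hyU

theorem IsWeakGradient.exists_ae_eq_const {N : ℕ} {Ω : Set (RN N)} {F : RN N → ℝ}
    (hw : IsWeakGradient Ω F 0) (hF : LocallyIntegrable F) (hΩ : IsDomainOfRN Ω) :
    ∃ c, ∀ᵐ x, x ∈ Ω → F x = c := by
  refine exists_ae_eq_const_of_isPreconnected hΩ.2.isPreconnected fun x hx => ?_
  obtain ⟨δ, hδ, hball⟩ := Metric.isOpen_iff.mp hΩ.1 x hx
  obtain ⟨φ, hφ, hlim⟩ := exists_bump_seq_ae_tendsto_mollify (half_pos (half_pos hδ)) hF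
  set B := Metric.ball x (δ / 2)
  have hB' : B ∈ 𝓝 x := Metric.ball_mem_nhds x (half_pos hδ)
  have hconst (n : ℕ) {y z : RN N} (hy : y ∈ B) (hz : z ∈ B) :
      mollify volume (φ n) F y = mollify volume (φ n) F z := by
    refine Metric.isOpen_ball.is_const_of_fderiv_eq_zero (𝕜 := ℝ)
      (convex_ball x _).isPreconnected
      ((contDiff_mollify (φ n) hF).differentiable one_ne_zero).differentiableOn (fun w hw' => ?_)
      hy hz
    have hsub : Metric.closedBall w (φ n).rOut ⊆ Ω :=
      (Metric.closedBall_subset_ball' (by linarith [hφ n, Metric.mem_ball.mp hw'])).trans hball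
    rw [hw.fderiv_mollify hF (locallyIntegrable_const 0) (φ n) hsub]
    simp [mollify]
  have hmem : ∀ᶠ y in 𝓝 x ⊓ ae volume, y ∈ B := mem_inf_of_left hB'
  have htendsto := hlim.filter_mono (inf_le_right : 𝓝 x ⊓ ae volume ≤ ae volume)
  have := neBot_nhds_inf_ae volume x
  obtain ⟨y, hyB, hy⟩ := (hmem.and htendsto).exists
  refine ⟨F y, ?_⟩
  filter_upwards [hmem, htendsto] with z hzB hz
  exact tendsto_nhds_unique hz (hy.congr fun n => hconst n hyB hzB)

section MollifyOperator

variable {E : Type*} [NormedAddCommGroup E] [NormedSpace ℝ E] [FiniteDimensional ℝ E]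
  [MeasurableSpace E] [BorelSpace E] {μ : Measure E} [μ.IsAddHaarMeasure] {s t : Set E}

theorem memLp_normed (φ : ContDiffBump (0 : E)) (p : ℝ≥0∞) : MemLp (φ.normed μ) p μ :=
  φ.continuous_normed.memLp_of_hasCompactSupport φ.hasCompactSupport_normed

variable (μ s) in
/-- The function `y ↦ φ(x - y)` as an element of `L²(s)`: the kernel of the mollification. -/
noncomputable def bumpTranslate (φ : ContDiffBump (0 : E)) (x : E) : Lp ℝ 2 (μ.restrict s) :=
  LpToLpRestrictCLM E ℝ ℝ μ 2 s (DomAddAct.mk (-x) +ᵥ (memLp_normed φ 2).toLp)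

theorem coeFn_bumpTranslate (φ : ContDiffBump (0 : E)) (x : E) :
    bumpTranslate μ s φ x =ᵐ[μ.restrict s] fun y => φ.normed μ (x - y) := by
  refine (LpToLpRestrictCLM_coeFn ℝ s _).trans (ae_restrict_of_ae ?_)
  rw [DomAddAct.mk_vadd_toLp]
  refine (MemLp.coeFn_toLp _).trans (Eventually.of_forall fun y => ?_)
  simp only [vadd_eq_add, neg_add_eq_sub]
  rw [← φ.normed_neg, neg_sub]

theorem continuous_bumpTranslate (φ : ContDiffBump (0 : E)) :
    Continuous (bumpTranslate μ s φ) := by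
  have : Fact ((2 : ℝ≥0∞) ≠ ⊤) := ⟨by simp⟩
  exact (ContinuousLinearMap.continuous _).comp
    ((DomAddAct.continuous_mk.comp continuous_neg).vadd continuous_const)

theorem norm_bumpTranslate_le (φ : ContDiffBump (0 : E)) (x : E) :
    ‖bumpTranslate μ s φ x‖ ≤ ‖(memLp_normed φ 2).toLp (φ.normed μ)‖ :=
  (norm_Lp_toLp_restrict_le s _).trans_eq (DomAddAct.norm_vadd_Lp _ _)

theorem inner_bumpTranslate (hs : MeasurableSet s) (φ : ContDiffBump (0 : E)) (x : E)
    (f : Lp ℝ 2 (μ.restrict s)) :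
    inner ℝ f (bumpTranslate μ s φ x) = mollify μ φ (s.indicator f) x := by
  calc inner ℝ f (bumpTranslate μ s φ x)
      = ∫ y in s, φ.normed μ (x - y) * f y ∂μ := by
        rw [L2.inner_def]
        refine integral_congr_ae ?_
        filter_upwards [coeFn_bumpTranslate φ x] with y hy
        simp [hy]
    _ = ∫ y, φ.normed μ (x - y) * s.indicator f y ∂μ := by
        simp only [← integral_indicator hs, indicator_mul_right]
    _ = mollify μ φ (s.indicator f) x := by rw [mollify, convolution_eq_swap]; rfl

theorem exists_isCompactOperator_mollify (hs : MeasurableSet s) (hμs : μ s ≠ ⊤)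
    (ht : MeasurableSet t) (φ : ContDiffBump (0 : E)) :
    ∃ T : Lp ℝ 2 (μ.restrict s) →L[ℝ] Lp ℝ 2 (μ.restrict s), IsCompactOperator T ∧
      ∀ f, T f =ᵐ[μ.restrict s] t.indicator (mollify μ φ (s.indicator f)) := by
  have : Fact (μ s < ⊤) := ⟨hμs.lt_top⟩
  have hK : MemLp (t.indicator (bumpTranslate μ s φ)) 2 (μ.restrict s) :=
    (MemLp.of_bound (continuous_bumpTranslate φ).aestronglyMeasurable _
      (Eventually.of_forall (norm_bumpTranslate_le φ))).indicator ht
  refine ⟨kernelOperator _ _ _ hK.toLp, isCompactOperator_kernelOperator (by simp) _,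
    fun f => ?_⟩
  filter_upwards [coeFn_kernelOperator hK.toLp f, hK.coeFn_toLp] with x hTx hKx
  rw [hTx, hKx]
  by_cases hx : x ∈ t
  · rw [indicator_of_mem hx, indicator_of_mem hx, inner_bumpTranslate hs]
  · rw [indicator_of_notMem hx, indicator_of_notMem hx, inner_zero_right]

end MollifyOperator

section InnerSet

variable {X : Type*} [PseudoMetricSpace X] {s : Set X} {δ : ℝ}

/-- The points of `s` at distance greater than `δ` from the complement of `s`. -/
def innerSet (s : Set X) (δ : ℝ) : Set X := (Metric.cthickening δ sᶜ)ᶜ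

theorem isOpen_innerSet (s : Set X) (δ : ℝ) : IsOpen (innerSet s δ) :=
  Metric.isClosed_cthickening.isOpen_compl

theorem innerSet_subset (s : Set X) (δ : ℝ) : innerSet s δ ⊆ s :=
  compl_subset_comm.mp (Metric.self_subset_cthickening _)

theorem closedBall_subset_of_mem_innerSet {x : X} (hx : x ∈ innerSet s δ) :
    Metric.closedBall x δ ⊆ s := by
  intro y hy
  by_contra hys
  exact hx (Metric.mem_cthickening_of_dist_le x y δ _ hys (by rwa [dist_comm]))

theorem tendsto_measure_compl_innerSet [MeasurableSpace X] [OpensMeasurableSpace X]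
    {μ : Measure X} (hs : IsOpen s) (hμs : μ s ≠ ⊤) :
    Tendsto (fun δ => μ.restrict s (innerSet s δ)ᶜ) (𝓝 0) (𝓝 0) := by
  have : Fact (μ s < ⊤) := ⟨hμs.lt_top⟩
  simpa [innerSet, hs.measurableSet] using
    tendsto_measure_cthickening_of_isClosed (μ := μ.restrict s)
      ⟨1, one_pos, measure_ne_top _ _⟩ hs.isClosed_compl

end InnerSet

section Compactness

variable {N : ℕ} {Ω : Set (RN N)}

theorem normOn_two_coeFn (f : L2 Ω) : normOn Ω 2 f = ‖f‖ₑ := by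
  rw [normOn, Lp.enorm_def, ENNReal.ofReal_ofNat]

theorem H1.isWeakGradient (f : H1 Ω) : IsWeakGradient Ω (H1.toL2 Ω f) (H1.grad Ω f) := f.2

theorem H1.norm_toL2_le (f : H1 Ω) : ‖H1.toL2 Ω f‖ ≤ ‖f‖ :=
  WithLp.norm_fst_le _ (f : WithLp 2 (L2 Ω × L2Vec Ω))

theorem H1.norm_grad_le (f : H1 Ω) : ‖H1.grad Ω f‖ ≤ ‖f‖ :=
  WithLp.norm_snd_le _ (f : WithLp 2 (L2 Ω × L2Vec Ω))

theorem H1.norm_le_norm_toL2_add_norm_grad (f : H1 Ω) :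
    ‖f‖ ≤ ‖H1.toL2 Ω f‖ + ‖H1.grad Ω f‖ := by
  have h : ‖f‖ ^ 2 = ‖H1.toL2 Ω f‖ ^ 2 + ‖H1.grad Ω f‖ ^ 2 :=
    WithLp.prod_norm_sq_eq_of_L2 (f : WithLp 2 (L2 Ω × L2Vec Ω))
  refine abs_le_of_sq_le_sq' ?_ (by positivity) |>.2
  nlinarith [mul_nonneg (norm_nonneg (H1.toL2 Ω f)) (norm_nonneg (H1.grad Ω f))]

theorem IsWeakGradient.congr_ae {F F' : RN N → ℝ} {G G' : RN N → RN N}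
    (hw : IsWeakGradient Ω F G) (hF : F =ᵐ[volume.restrict Ω] F')
    (hG : G =ᵐ[volume.restrict Ω] G') : IsWeakGradient Ω F' G' := by
  intro φ hφ i
  have hF' : ∫ x in Ω, F' x * partialDeriv i φ x = ∫ x in Ω, F x * partialDeriv i φ x :=
    integral_congr_ae (by filter_upwards [hF] with x hx using by rw [hx])
  have hG' : ∫ x in Ω, G' x i * φ x = ∫ x in Ω, G x i * φ x :=
    integral_congr_ae (by filter_upwards [hG] with x hx using by rw [hx])
  rw [hF', hG', hw φ hφ i]

theorem integrable_indicator_coeFn {V : Type*} [NormedAddCommGroup V] (hΩ : MeasurableSet Ω)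
    (hfin : volume Ω < ⊤) (f : Lp V 2 (volume.restrict Ω)) : Integrable (Ω.indicator f) := by
  have : Fact (volume Ω < ⊤) := ⟨hfin⟩
  exact (integrable_indicator_iff hΩ).mpr ((Lp.memLp f).integrable one_le_two)

theorem H1.eLpNorm_mollify_sub_le (hΩ : MeasurableSet Ω) (hfin : volume Ω < ⊤) (f : H1 Ω)
    (φ : ContDiffBump (0 : RN N)) :
    eLpNorm (mollify volume φ (Ω.indicator (H1.toL2 Ω f)) - Ω.indicator (H1.toL2 Ω f)) 2
      (volume.restrict (innerSet Ω (2 * φ.rOut))) ≤ ENNReal.ofReal φ.rOut * ‖H1.grad Ω f‖ₑ := by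
  have hw : IsWeakGradient Ω (Ω.indicator (H1.toL2 Ω f)) (Ω.indicator (H1.grad Ω f)) :=
    (H1.isWeakGradient f).congr_ae (indicator_ae_eq_restrict hΩ).symm
      (indicator_ae_eq_restrict hΩ).symm
  rw [Lp.enorm_def, ← eLpNorm_indicator_eq_eLpNorm_restrict hΩ]
  exact hw.eLpNorm_mollify_sub_le
    (integrable_indicator_coeFn hΩ hfin (H1.toL2 Ω f)).locallyIntegrable
    ((Lp.stronglyMeasurable _).indicator hΩ)
    (integrable_indicator_coeFn hΩ hfin (H1.grad Ω f)).locallyIntegrable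
    ((Lp.stronglyMeasurable _).indicator hΩ) one_le_two (by simp)
    (isOpen_innerSet _ _).measurableSet φ fun _ => closedBall_subset_of_mem_innerSet

theorem H1.exists_isCompactOperator_enorm_toL2_sub_le (hΩ : IsOpen Ω) (hfin : volume Ω < ⊤)
    {q : ℝ} (hq : 2 < q) {C : ℝ≥0}
    (hC : ∀ f : H1 Ω, normOn Ω q (H1.toL2 Ω f) ≤ C * ‖f‖ₑ) {δ : ℝ} (hδ : 0 < δ) :
    ∃ S : H1 Ω →L[ℝ] L2 Ω, IsCompactOperator S ∧ ∀ f, ‖H1.toL2 Ω f - S f‖ₑ ≤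
      (ENNReal.ofReal δ +
        C * volume.restrict Ω (innerSet Ω (2 * δ))ᶜ ^ (1 / 2 - 1 / q)) * ‖f‖ₑ := by
  let φ : ContDiffBump (0 : RN N) := ⟨δ / 2, δ, half_pos hδ, half_lt_self hδ⟩
  set A := innerSet Ω (2 * δ)
  have hAm : MeasurableSet A := (isOpen_innerSet Ω (2 * δ)).measurableSet
  obtain ⟨T, hT, hTf⟩ := exists_isCompactOperator_mollify hΩ.measurableSet hfin.ne hAm φ
  refine ⟨T ∘L H1.toL2 Ω, hT.comp_clm _, fun f => ?_⟩
  set F := H1.toL2 Ω f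
  have hsub : ∀ᵐ x ∂volume.restrict Ω, (F - T F : L2 Ω) x =
      F x - A.indicator (mollify volume φ (Ω.indicator F)) x := by
    filter_upwards [hTf F, Lp.coeFn_sub F (T F)] with x hTx hx
    rw [hx, Pi.sub_apply, hTx]
  have inner_le : eLpNorm (F - T F : L2 Ω) 2 ((volume.restrict Ω).restrict A) ≤
      ENNReal.ofReal δ * ‖f‖ₑ := by
    have hae : (F - T F : L2 Ω) =ᵐ[(volume.restrict Ω).restrict A]
        Ω.indicator F - mollify volume φ (Ω.indicator F) := by
      filter_upwards [ae_restrict_of_ae hsub, ae_restrict_mem hAm] with x hx hxA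
      rw [hx, Pi.sub_apply, indicator_of_mem hxA, indicator_of_mem (innerSet_subset _ _ hxA)]
    rw [eLpNorm_congr_ae hae, Measure.restrict_restrict_of_subset (innerSet_subset _ _),
      eLpNorm_sub_comm]
    refine (H1.eLpNorm_mollify_sub_le hΩ.measurableSet hfin f φ).trans ?_
    gcongr
    exact enorm_le_iff_norm_le.mpr (H1.norm_grad_le f)
  have outer_le : eLpNorm (F - T F : L2 Ω) 2 ((volume.restrict Ω).restrict Aᶜ) ≤
      C * ‖f‖ₑ * volume.restrict Ω Aᶜ ^ (1 / 2 - 1 / q) := by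
    have hae : (F - T F : L2 Ω) =ᵐ[(volume.restrict Ω).restrict Aᶜ] F := by
      filter_upwards [ae_restrict_of_ae hsub, ae_restrict_mem hAm.compl] with x hx hxA
      rw [hx, indicator_of_notMem hxA, sub_zero]
    have holder := eLpNorm_restrict_le_mul_rpow_measure (p := 2) (q := ENNReal.ofReal q)
      (by simpa using ENNReal.ofReal_le_ofReal hq.le) (Lp.aestronglyMeasurable F) Aᶜ
    rw [ENNReal.toReal_ofNat, ENNReal.toReal_ofReal (by linarith)] at holder
    rw [eLpNorm_congr_ae hae]
    exact holder.trans (mul_le_mul_left (hC f) _)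
  rw [add_mul, mul_right_comm (C : ℝ≥0∞), Lp.enorm_def]
  exact (eLpNorm_le_eLpNorm_restrict_add (Lp.aestronglyMeasurable _) hAm one_le_two).trans
    (add_le_add inner_le outer_le)

theorem isCompactOperator_toL2 (hΩ : IsOpen Ω) (hfin : volume Ω < ⊤) {q : ℝ} (hq : 2 < q)
    {C : ℝ≥0} (hC : ∀ f : H1 Ω, normOn Ω q (H1.toL2 Ω f) ≤ C * ‖f‖ₑ) :
    IsCompactOperator (H1.toL2 Ω) := by
  refine isCompactOperator_of_forall_exists_enorm_sub_le fun ε hε => ?_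
  have hexp : 0 < 1 / 2 - 1 / q :=
    sub_pos.mpr (one_div_lt_one_div_of_lt two_pos hq)
  have hdbl : Tendsto (fun δ : ℝ => 2 * δ) (𝓝 0) (𝓝 0) := by
    simpa using (continuous_const_mul (2 : ℝ)).tendsto 0
  have outer : Tendsto (fun δ : ℝ =>
      C * volume.restrict Ω (innerSet Ω (2 * δ))ᶜ ^ (1 / 2 - 1 / q)) (𝓝 0) (𝓝 0) := by
    have hmeas := ((tendsto_measure_compl_innerSet hΩ hfin.ne).comp hdbl).ennrpow_const
      (1 / 2 - 1 / q)
    rw [ENNReal.zero_rpow_of_pos hexp] at hmeas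
    simpa only [mul_zero, Function.comp_apply] using
      ENNReal.Tendsto.const_mul hmeas (Or.inr ENNReal.coe_ne_top)
  have bound : Tendsto (fun δ : ℝ => ENNReal.ofReal δ +
      C * volume.restrict Ω (innerSet Ω (2 * δ))ᶜ ^ (1 / 2 - 1 / q)) (𝓝[>] 0) (𝓝 0) := by
    simpa using ((ENNReal.continuous_ofReal.tendsto 0).add outer).mono_left nhdsWithin_le_nhds
  obtain ⟨δ, hδε, hδ⟩ := ((bound.eventually_le_const (ENNReal.coe_pos.mpr hε)).and
    self_mem_nhdsWithin).exists
  obtain ⟨S, hS, hle⟩ := H1.exists_isCompactOperator_enorm_toL2_sub_le hΩ hfin hq hC hδ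
  exact ⟨S, hS, fun f => (hle f).trans (mul_le_mul_left hδε _)⟩

end Compactness

theorem exists_gnsAdmissible_two (N : ℕ) :
    ∃ q : ℝ, 2 < q ∧ GNSAdmissible N 2 q ∧ 0 ≤ gnsTheta 2 q N ∧ gnsTheta 2 q N ≤ 1 := by
  rcases le_or_gt N 2 with h | h
  · refine ⟨4, by norm_num, Or.inl ⟨h, by norm_num, by norm_num⟩, ?_⟩
    interval_cases N <;> norm_num [gnsTheta]
  · have hN : (2 : ℝ) < N := mod_cast h
    have two_lt : 2 < sobolevExponent N := by
      rw [sobolevExponent, lt_div_iff₀ (by linarith)]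
      linarith
    have theta_eq : gnsTheta 2 (sobolevExponent N) N = 1 := by
      have : (N : ℝ) - 2 ≠ 0 := by linarith
      rw [gnsTheta, sobolevExponent]
      field_simp
    exact ⟨sobolevExponent N, two_lt, Or.inr ⟨h, Or.inl ⟨two_pos, two_lt, le_rfl⟩⟩,
      by simp [theta_eq]⟩

theorem SupportsGNS.exists_embedding {N : ℕ} {Ω : Set (RN N)} (h : SupportsGNS Ω) :
    ∃ q : ℝ, 2 < q ∧ ∃ C : ℝ≥0, ∀ f : H1 Ω, normOn Ω q (H1.toL2 Ω f) ≤ C * ‖f‖ₑ := by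
  obtain ⟨q, hq, hadm, hθ, hθ'⟩ := exists_gnsAdmissible_two N
  obtain ⟨C_S, -, hC_S⟩ := h
  refine ⟨q, hq, (C_S 2 q).toNNReal * 2, fun f => ?_⟩
  have toL2_le : ‖H1.toL2 Ω f‖ₑ ≤ 2 * ‖f‖ₑ :=
    (enorm_le_iff_norm_le.mpr (H1.norm_toL2_le f)).trans (le_mul_of_one_le_left' one_le_two)
  have sum_le : ENNReal.ofReal (‖H1.grad Ω f‖ + ‖H1.toL2 Ω f‖) ≤ 2 * ‖f‖ₑ := by
    rw [ENNReal.ofReal_add (norm_nonneg _) (norm_nonneg _), ofReal_norm, ofReal_norm, two_mul]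
    exact add_le_add (enorm_le_iff_norm_le.mpr (H1.norm_grad_le f))
      (enorm_le_iff_norm_le.mpr (H1.norm_toL2_le f))
  have gns := (hC_S 2 q hadm).2 f (by rw [normOn_two_coeFn]; exact enorm_lt_top)
  rw [normOn_two_coeFn] at gns
  calc normOn Ω q (H1.toL2 Ω f)
      ≤ ENNReal.ofReal (C_S 2 q) * (2 * ‖f‖ₑ) ^ gnsTheta 2 q N *
          (2 * ‖f‖ₑ) ^ (1 - gnsTheta 2 q N) := by
        refine gns.trans ?_
        have := sub_nonneg.mpr hθ'
        gcongr
    _ = ((C_S 2 q).toNNReal * 2 : ℝ≥0) * ‖f‖ₑ := by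
        rw [mul_assoc, ← ENNReal.rpow_add_of_nonneg _ _ hθ (sub_nonneg.mpr hθ'),
          add_sub_cancel, ENNReal.rpow_one, ENNReal.coe_mul, mul_assoc]
        rfl

theorem continuous_integral_mul {α : Type*} [MeasurableSpace α] {μ : Measure α} {ξ : α → ℝ}
    (hξ : MemLp ξ 2 μ) : Continuous fun v : Lp ℝ 2 μ => ∫ x, v x * ξ x ∂μ := by
  have integral_eq (v : Lp ℝ 2 μ) : ∫ x, v x * ξ x ∂μ = inner ℝ hξ.toLp v := by
    rw [L2.inner_def]
    refine integral_congr_ae ?_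
    filter_upwards [hξ.coeFn_toLp] with x hx
    simp [hx]
  simp only [integral_eq]
  fun_prop

theorem norm_sub_const_average_le {α : Type*} [MeasurableSpace α] {μ : Measure α}
    [IsFiniteMeasure μ] (f : Lp ℝ 2 μ) (c : ℝ) :
    ‖f - Lp.const 2 μ (⨍ x, f x ∂μ)‖ ≤ ‖f - Lp.const 2 μ c‖ := by
  set m := ⨍ x, f x ∂μ with hm
  have orthogonal : inner ℝ (f - Lp.const 2 μ m) (Lp.const 2 μ (m - c)) = 0 := by
    calc inner ℝ (f - Lp.const 2 μ m) (Lp.const 2 μ (m - c))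
        = ∫ x, (m - c) * (f x - m) ∂μ := by
          rw [L2.inner_def]
          refine integral_congr_ae ?_
          filter_upwards [Lp.coeFn_sub f (Lp.const 2 μ m), Lp.coeFn_const (p := 2) (μ := μ) m,
            Lp.coeFn_const (p := 2) (μ := μ) (m - c)] with x hsub h1 h2
          rw [hsub, Pi.sub_apply, h1, h2]
          rfl
      _ = 0 := by
          rw [integral_const_mul, hm, integral_sub_average, mul_zero]
  have decomposition : f - Lp.const 2 μ c = (f - Lp.const 2 μ m) + Lp.const 2 μ (m - c) := by
    rw [map_sub]
    abel
  have pythagoras := norm_add_sq_eq_norm_sq_add_norm_sq_of_inner_eq_zero _ _ orthogonal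
  rw [← decomposition] at pythagoras
  nlinarith [norm_nonneg (f - Lp.const 2 μ c), mul_self_nonneg ‖Lp.const 2 μ (m - c)‖]

section Poincare

variable {N : ℕ} {Ω : Set (RN N)}

theorem isClosed_H1 (Ω : Set (RN N)) : IsClosed (H1 Ω : Set (WithLp 2 (L2 Ω × L2Vec Ω))) := by
  change IsClosed {p : WithLp 2 (L2 Ω × L2Vec Ω) | ∀ φ, IsTestFun Ω φ → ∀ i,
    ∫ x in Ω, p.fst x * partialDeriv i φ x = -∫ x in Ω, p.snd x i * φ x}
  simp only [ofPred_forall]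
  refine isClosed_iInter fun φ => isClosed_iInter fun hφ => isClosed_iInter fun i =>
    isClosed_eq ?_ (Continuous.neg ?_)
  · exact (continuous_integral_mul (hφ.memLp_partialDeriv i)).comp (WithLp.fstL 2 ℝ _ _).continuous
  · let coord := (EuclideanSpace.proj (𝕜 := ℝ) i : RN N →L[ℝ] ℝ).compLpL 2 (volume.restrict Ω)
    have coord_eq (g : L2Vec Ω) : ∫ x in Ω, g x i * φ x = ∫ x in Ω, coord g x * φ x := by
      refine integral_congr_ae ?_
      filter_upwards [ContinuousLinearMap.coeFn_compLpL
        (EuclideanSpace.proj (𝕜 := ℝ) i : RN N →L[ℝ] ℝ) g] with x hx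
      rw [hx, PiLp.proj_apply]
    simp only [coord_eq]
    exact (continuous_integral_mul hφ.memLp).comp
      (coord.continuous.comp (WithLp.sndL 2 ℝ _ _).continuous)

theorem H1.exists_toL2_eq_const (hΩ : IsDomainOfRN Ω) [IsFiniteMeasure (volume.restrict Ω)]
    {f : H1 Ω} (hf : H1.grad Ω f = 0) :
    ∃ c : ℝ, H1.toL2 Ω f = Lp.const 2 (volume.restrict Ω) c := by
  have hΩm := hΩ.1.measurableSet
  have hw : IsWeakGradient Ω (Ω.indicator (H1.toL2 Ω f)) 0 :=
    (H1.isWeakGradient f).congr_ae (indicator_ae_eq_restrict hΩm).symm (by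
      rw [hf]
      exact Lp.coeFn_zero _ _ _)
  have hfin : volume Ω < ⊤ := by simpa using measure_lt_top (volume.restrict Ω) univ
  obtain ⟨c, hc⟩ :=
    hw.exists_ae_eq_const (integrable_indicator_coeFn hΩm hfin _).locallyIntegrable hΩ
  refine ⟨c, Lp.ext ?_⟩
  filter_upwards [ae_restrict_of_ae hc, ae_restrict_mem hΩm,
    Lp.coeFn_const (p := 2) (μ := volume.restrict Ω) c] with x hx hxΩ hconst
  rw [hconst, Function.const_apply, ← hx hxΩ, indicator_of_mem hxΩ]

theorem normOn_two_sub_meanOn [IsFiniteMeasure (volume.restrict Ω)] (f : L2 Ω) :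
    normOn Ω 2 (fun x => f x - meanOn Ω f) =
      ‖f - Lp.const 2 (volume.restrict Ω) (⨍ x in Ω, f x)‖ₑ := by
  rw [← normOn_two_coeFn]
  refine eLpNorm_congr_ae ?_
  have mean_eq : meanOn Ω f = ⨍ x in Ω, f x := by
    rw [meanOn, setAverage_eq, smul_eq_mul, inv_mul_eq_div]
  filter_upwards [Lp.coeFn_sub f (Lp.const 2 (volume.restrict Ω) (⨍ x in Ω, f x)),
    Lp.coeFn_const (p := 2) (μ := volume.restrict Ω) (⨍ x in Ω, f x)] with x hsub hconst
  rw [hsub, Pi.sub_apply, hconst, Function.const_apply, mean_eq]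

theorem supportsPoincare_of_isCompactOperator (hΩ : IsDomainOfRN Ω) (hfin : volume Ω < ⊤)
    (hcomp : IsCompactOperator (H1.toL2 Ω)) : SupportsPoincare Ω := by
  have : Fact (volume Ω < ⊤) := ⟨hfin⟩
  have : CompleteSpace (H1 Ω) := (isClosed_H1 Ω).completeSpace_coe
  obtain ⟨C, hC, hle⟩ :=
    exists_norm_sub_starProjection_ker_le hcomp H1.norm_le_norm_toL2_add_norm_grad
  refine ⟨C, hC, fun f => ?_⟩
  set k := (H1.grad Ω).ker.starProjection f
  have grad_k : H1.grad Ω k = 0 := (H1.grad Ω).ker.starProjection_apply_mem f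
  obtain ⟨c, hc⟩ := H1.exists_toL2_eq_const hΩ grad_k
  rw [normOn_two_sub_meanOn, ← ofReal_norm]
  refine ENNReal.ofReal_le_ofReal ?_
  calc ‖H1.toL2 Ω f - Lp.const 2 (volume.restrict Ω) (⨍ x in Ω, H1.toL2 Ω f x)‖
      ≤ ‖H1.toL2 Ω f - Lp.const 2 (volume.restrict Ω) c‖ := norm_sub_const_average_le _ c
    _ = ‖H1.toL2 Ω (f - k)‖ := by rw [map_sub, hc]
    _ ≤ ‖f - k‖ := H1.norm_toL2_le _
    _ ≤ C * ‖H1.grad Ω f‖ := hle f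

end Poincare

theorem proposition5p3_general {N : ℕ} {Ω : Set (RN N)} (hΩ : IsDomainOfRN Ω)
    (hfin : volume Ω < ⊤) {q : ℝ} (hq : 2 < q) {C : ℝ≥0}
    (hC : ∀ f : H1 Ω, normOn Ω q (H1.toL2 Ω f) ≤ C * ‖f‖ₑ) :
    IsCompactOperator (H1.toL2 Ω) ∧ SupportsPoincare Ω :=
  have hcomp := isCompactOperator_toL2 hΩ.1 hfin hq hC
  ⟨hcomp, supportsPoincare_of_isCompactOperator hΩ hfin hcomp⟩

theorem proposition5p3 (N : ℕ) (hN : 1 ≤ N) (Ω : Set (RN N)) (hΩ : IsDomainOfRN Ω)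
    (hfin : (volume : Measure (RN N)) Ω < ⊤) (hGNS : SupportsGNS Ω) :
    IsCompactOperator (H1.toL2 Ω) ∧ SupportsPoincare Ω := by
  obtain ⟨q, hq, C, hC⟩ := hGNS.exists_embedding
  exact proposition5p3_general hΩ hfin hq hC
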